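/- Let $G$ be a finite simple connected graph in which every node has degree at least $2$. The non-backtracking (NB) matrix $B$ of $G$ is indexed by the oriented edges of $G$ and has entries $B_{k\to l,\,i\to j}=\delta_{jk}(1-\delta_{il})$. Assume that $B$ is diagonalizable over $\mathbb{C}$. Let $G^c$ be the graph obtained from $G$ by adding one new node $c$ and joining it to a set $S$ of $d\ge 2$ nodes of $G$, and let $B^c$ be the NB-matrix of $G^c$. Call the oriented edges of $G$ old and the $2d$ oriented edges of $G^c$ incident to $c$ new, and write $B^c$ in block form $$B^c=\begin{pmatrix}B&D\\E&F\end{pmatrix},$$ with the old edges first. Put $X=DFE$ (so that $X_{k\to l,\,i\to j}=1$ if $j\ne k$ and $j,k\in S$, and $X_{k\to l,\,i\to j}=0$ otherwise), and $Y(t)=(B-tI)^{-1}$ whenever $t$ is not an eigenvalue of $B$. The Perron eigenvalue of a square matrix is its positive real eigenvalue whose modulus is the largest among all its complex eigenvalues, if there is one. Then $B$ has a Perron eigenvalue $\lambda$, and there is a real number $\lambda_c>\lambda$ such that $B-\lambda_cI$ is invertible, $-\lambda_c^2$ is an eigenvalue of $Y(\lambda_c)X$, and $\lambda_c$ is an eigenvalue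 of $B^c$, in fact the Perron eigenvalue of $B^c$. In particular the Perron NB-eigenvalue strictly increases when the node $c$ is added. -/

import Mathlib

/-- The non-backtracking matrix of `G`, indexed by the oriented edges of `G`: the entry in row
`k → l` and column `i → j` is `δ_{jk} (1 - δ_{il})`. -/
def nbMatrix {V : Type*} [DecidableEq V] (G : SimpleGraph V) : Matrix G.Dart G.Dart ℂ :=
  Matrix.of fun e f => if f.snd = e.fst ∧ f.fst ≠ e.snd then 1 else 0

/-- The complex matrix `M` is diagonalizable. -/
def IsDiagonalizableMatrix {n : Type*} [Fintype n] [DecidableEq n] (M : Matrix n n ℂ) : Prop :=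
  ∃ (Z : Matrix n n ℂ) (d : n → ℂ), IsUnit Z ∧ M = Z * Matrix.diagonal d * Z⁻¹

/-- `μ` is an eigenvalue of the matrix `M`. -/
def IsMatrixEigenvalue {n : Type*} [Fintype n] [DecidableEq n] (M : Matrix n n ℂ) (μ : ℂ) : Prop :=
  Module.End.HasEigenvalue (Matrix.toLin' M) μ

/-- `r` is the Perron eigenvalue of `M`: a positive real eigenvalue that is leading, that is,
whose modulus is the spectral radius of `M`. -/
def IsPerronEigenvalue {n : Type*} [Fintype n] [DecidableEq n] (M : Matrix n n ℂ) (r : ℝ) : Prop :=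
  0 < r ∧ IsMatrixEigenvalue M (r : ℂ) ∧ ∀ μ : ℂ, IsMatrixEigenvalue M μ → ‖μ‖ ≤ r

/-- The graph obtained from `G` by adding one new node, `none`, and joining it to the nodes of `G`
that lie in `S`. -/
def addNode {V : Type*} (G : SimpleGraph V) (S : Finset V) : SimpleGraph (Option V) where
  Adj
    | some u, some v => G.Adj u v
    | some u, none => u ∈ S
    | none, some v => v ∈ S
    | none, none => False
  symm := ⟨by
    rintro (_ | u) (_ | v) h
    · exact h
    · exact h
    · exact h
    · exact SimpleGraph.Adj.symm h⟩
  loopless := ⟨by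
    rintro (_ | u) h
    · exact h
    · exact G.irrefl h⟩

instance addNode_decidableRel {V : Type*} [DecidableEq V] (G : SimpleGraph V) [DecidableRel G.Adj]
    (S : Finset V) : DecidableRel (addNode G S).Adj
  | some u, some v => inferInstanceAs (Decidable (G.Adj u v))
  | some u, none => inferInstanceAs (Decidable (u ∈ S))
  | none, some v => inferInstanceAs (Decidable (v ∈ S))
  | none, none => inferInstanceAs (Decidable False)

/-- An oriented edge of `G`, seen as an oriented edge of `addNode G S`. -/
def oldDart {V : Type*} (G : SimpleGraph V) (S : Finset V) (e : G.Dart) : (addNode G S).Dart :=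
  ⟨(some e.fst, some e.snd), e.adj⟩

/-- The oriented edges of `addNode G S` that are incident to the new node. -/
abbrev NewDart {V : Type*} (G : SimpleGraph V) (S : Finset V) : Type _ :=
  {e : (addNode G S).Dart // e.fst = none ∨ e.snd = none}

/-- The block of the non-backtracking matrix of `addNode G S` with old rows and new columns. -/
def blockD {V : Type*} [DecidableEq V] (G : SimpleGraph V) (S : Finset V) :
    Matrix G.Dart (NewDart G S) ℂ :=
  (nbMatrix (addNode G S)).submatrix (oldDart G S) Subtype.val

/-- The block of the non-backtracking matrix of `addNode G S` with new rows and old columns. -/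
def blockE {V : Type*} [DecidableEq V] (G : SimpleGraph V) (S : Finset V) :
    Matrix (NewDart G S) G.Dart ℂ :=
  (nbMatrix (addNode G S)).submatrix Subtype.val (oldDart G S)

/-- The block of the non-backtracking matrix of `addNode G S` with new rows and new columns. -/
def blockF {V : Type*} [DecidableEq V] (G : SimpleGraph V) (S : Finset V) :
    Matrix (NewDart G S) (NewDart G S) ℂ :=
  (nbMatrix (addNode G S)).submatrix Subtype.val Subtype.val

/-- The matrix `X = D F E`. -/
def nodeX {V : Type*} [Fintype V] [DecidableEq V] (G : SimpleGraph V) [DecidableRel G.Adj]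
    (S : Finset V) : Matrix G.Dart G.Dart ℂ :=
  blockD G S * blockF G S * blockE G S

/-- The resolvent `Y(t) = (B - t I)⁻¹` of the non-backtracking matrix `B` of `G`. -/
noncomputable def resolventY {V : Type*} [Fintype V] [DecidableEq V] (G : SimpleGraph V)
    [DecidableRel G.Adj] (t : ℂ) : Matrix G.Dart G.Dart ℂ :=
  (nbMatrix G - t • (1 : Matrix G.Dart G.Dart ℂ))⁻¹

/-! The engine is a Collatz–Wielandt argument: a nonnegative matrix `A` with `τ x ≤ A x` for some
nonnegative `x ≠ 0` and `τ > 0` has a Perron eigenvalue at least `τ`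
(`exists_isPerronEigenvalue_ge`). Applied to `B` and the all-ones vector, it yields `λ`.

The modulus of a `λ`-eigenvector of `B`, extended by zero to the new darts, satisfies `λ x ≤ B^c x`.
Although `B` itself may be reducible (as for a cycle), `B^c` is irreducible
(`reflTransGen_nbStep_addNode`): a walk can turn around through `c`. Since `x` vanishes on new
darts, it is not an eigenvector of `B^c`; irreducibility then improves `λ` to a strictly larger `τ`
(`exists_gt_le_mulVec`), and the engine gives `λ_c ≥ τ > λ`.

Finally, write an eigenvector of `B^c` for `t = λ_c` as `(x, y)`. From `DE = 0` and `F² = 0` one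
gets `t² D y = X x`, so `(B - t) x = -D y` becomes `Y(t) X x = -t² x`. -/

open Matrix

/-! ### Perron–Frobenius theory for nonnegative matrices. -/

section Perron

variable {n : Type*} [Fintype n] [DecidableEq n]

lemma isMatrixEigenvalue_iff (M : Matrix n n ℂ) (μ : ℂ) :
    IsMatrixEigenvalue M μ ↔ ∃ v : n → ℂ, v ≠ 0 ∧ M *ᵥ v = μ • v := by
  unfold IsMatrixEigenvalue
  constructor
  · intro h
    obtain ⟨v, hv⟩ := h.exists_hasEigenvector
    exact ⟨v, hv.2, by simpa using hv.apply_eq_smul⟩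
  · rintro ⟨v, hv, h⟩
    exact Module.End.hasEigenvalue_of_hasEigenvector
      (Module.End.hasEigenvector_iff.2 ⟨Module.End.mem_eigenspace_iff.2 (by simpa using h), hv⟩)

omit [DecidableEq n] in
lemma mulVec_map_ofReal (A : Matrix n n ℝ) (v : n → ℝ) (i : n) :
    (A.map Complex.ofReal *ᵥ fun j => (v j : ℂ)) i = ((A *ᵥ v) i : ℝ) := by
  simp [Matrix.mulVec, dotProduct]

lemma isMatrixEigenvalue_of_det_eq_zero {A : Matrix n n ℝ} {t : ℝ}
    (h : (t • (1 : Matrix n n ℝ) - A).det = 0) :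
    IsMatrixEigenvalue (A.map Complex.ofReal) t := by
  obtain ⟨v, hv, hv0⟩ := Matrix.exists_mulVec_eq_zero_iff.2 h
  refine (isMatrixEigenvalue_iff _ _).2 ⟨fun j => (v j : ℂ), ?_, ?_⟩
  · intro h0
    exact hv (funext fun j => by simpa using congrFun h0 j)
  · have h1 : A *ᵥ v = t • v := by
      rw [Matrix.sub_mulVec, Matrix.smul_mulVec, Matrix.one_mulVec, sub_eq_zero] at hv0
      exact hv0.symm
    funext i
    rw [mulVec_map_ofReal, h1]
    simp

/-- If `t` exceeds no real eigenvalue of the nonnegative matrix `A` on `[τ, ∞)`, the equation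
`(τ - A) u = 1` has a positive solution. -/
lemma exists_pos_strict_supersolution [Nonempty n] {A : Matrix n n ℝ} (hA : ∀ i j, 0 ≤ A i j)
    {τ : ℝ} (hτ : 0 < τ) (hdet : ∀ t, τ ≤ t → (t • (1 : Matrix n n ℝ) - A).det ≠ 0) :
    ∃ u : n → ℝ, (∀ i, 0 < u i) ∧ ∀ i, (A *ᵥ u) i < τ * u i := by
  set M : ℝ → Matrix n n ℝ := fun t => t • (1 : Matrix n n ℝ) - A with hM
  have hMc : Continuous M := by fun_prop
  -- Cramer's form of `(t - A)⁻¹ 1`, which is visibly continuous in `t`.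
  set u : ℝ → n → ℝ := fun t => (M t).det⁻¹ • ((M t).adjugate *ᵥ 1) with hu
  have hsol : ∀ t, τ ≤ t → ∀ i, t * u t i = 1 + (A *ᵥ u t) i := by
    intro t ht i
    have h1 : M t *ᵥ u t = 1 := by
      simp only [hu, Matrix.mulVec_smul, Matrix.mulVec_mulVec, Matrix.mul_adjugate,
        Matrix.smul_mulVec, Matrix.one_mulVec, smul_smul]
      rw [inv_mul_cancel₀ (hdet t ht), one_smul]
    have h2 := congrFun h1 i
    simp only [hM, Matrix.sub_mulVec, Matrix.smul_mulVec, Matrix.one_mulVec, Pi.sub_apply,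
      Pi.smul_apply, smul_eq_mul, Pi.one_apply] at h2
    linarith
  have hne : (Finset.univ : Finset n).Nonempty := Finset.univ_nonempty
  set m : ℝ → ℝ := fun t => Finset.univ.inf' hne (u t) with hm
  -- The least entry `m` of the solution never vanishes on `[τ, ∞)`, so positivity at one large `T`
  -- propagates down to `τ`.
  have hpos : ∀ t, τ ≤ t → 0 ≤ m t → 0 < m t := by
    intro t ht h0
    have hu0 : ∀ i, 0 ≤ u t i := fun i => h0.trans (Finset.inf'_le _ (Finset.mem_univ i))
    rw [hm]
    refine (Finset.lt_inf'_iff _).2 fun i _ => ?_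
    have h1 := hsol t ht i
    have h2 : 0 ≤ (A *ᵥ u t) i := Finset.sum_nonneg fun j _ => mul_nonneg (hA i j) (hu0 j)
    have h3 : 0 < t * u t i := by linarith
    exact pos_of_mul_pos_right h3 (hτ.le.trans ht)
  have hcont : ContinuousOn m (Set.Ici τ) := by
    refine ContinuousOn.finset_inf'_apply hne fun i _ => ?_
    have h1 : ContinuousOn (fun t => (M t).det⁻¹) (Set.Ici τ) :=
      ContinuousOn.inv₀ (hMc.matrix_det).continuousOn fun t ht => hdet t ht
    have h2 : Continuous fun t => ((M t).adjugate *ᵥ (1 : n → ℝ)) i :=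
      (continuous_apply i).comp (hMc.matrix_adjugate.matrix_mulVec continuous_const)
    exact h1.mul h2.continuousOn
  obtain ⟨T, hT, hrow⟩ : ∃ T, τ ≤ T ∧ ∀ i, ∑ j, A i j < T := by
    refine ⟨τ + ∑ i, ∑ j, A i j, ?_, fun i => ?_⟩
    · have : 0 ≤ ∑ i, ∑ j, A i j :=
        Finset.sum_nonneg fun i _ => Finset.sum_nonneg fun j _ => hA i j
      linarith
    · have := Finset.single_le_sum (f := fun i => ∑ j, A i j)
        (fun i _ => Finset.sum_nonneg fun j _ => hA i j) (Finset.mem_univ i)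
      linarith
  have hmT : 0 < m T := by
    obtain ⟨i, _, hi⟩ := Finset.exists_mem_eq_inf' hne (u T)
    have h1 := hsol T hT i
    have h2 : (∑ j, A i j) * u T i ≤ (A *ᵥ u T) i := by
      rw [Finset.sum_mul]
      refine Finset.sum_le_sum fun j _ => mul_le_mul_of_nonneg_left ?_ (hA i j)
      rw [← hi]
      exact Finset.inf'_le _ (Finset.mem_univ j)
    have h3 : 0 < (T - ∑ j, A i j) * u T i := by linarith
    have h4 : 0 < u T i := pos_of_mul_pos_right h3 (by linarith [hrow i])
    rwa [← hi] at h4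
  have hmτ : 0 < m τ := by
    by_contra h
    obtain ⟨t, ht, h0⟩ := intermediate_value_Icc hT (hcont.mono Set.Icc_subset_Ici_self)
      (show (0 : ℝ) ∈ Set.Icc (m τ) (m T) from ⟨not_lt.1 h, hmT.le⟩)
    exact absurd (hpos t ht.1 h0.ge) (by rw [h0]; exact lt_irrefl 0)
  refine ⟨u τ, fun i => hmτ.trans_le (Finset.inf'_le _ (Finset.mem_univ i)), fun i => ?_⟩
  have := hsol τ le_rfl i
  linarith

/-- A nonnegative matrix with a nonnegative subinvariant vector for `τ` has a real eigenvalue that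
is at least `τ`. -/
lemma exists_det_eq_zero_of_le_mulVec {A : Matrix n n ℝ} (hA : ∀ i j, 0 ≤ A i j)
    {τ : ℝ} (hτ : 0 < τ) {x : n → ℝ} (hx : ∀ i, 0 ≤ x i) (hx0 : x ≠ 0)
    (h : ∀ i, τ * x i ≤ (A *ᵥ x) i) :
    ∃ t, τ ≤ t ∧ (t • (1 : Matrix n n ℝ) - A).det = 0 := by
  obtain ⟨k, hk⟩ := Function.ne_iff.1 hx0
  have : Nonempty n := ⟨k⟩
  by_contra! hdet
  obtain ⟨u, hu, hAu⟩ := exists_pos_strict_supersolution hA hτ hdet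
  -- The smallest multiple `c u` above `x` touches it at `i`, where `τ c u_i ≤ (A x)_i ≤ c (A u)_i <
  -- τ c u_i`.
  obtain ⟨i, hi⟩ := Finite.exists_max fun i => x i / u i
  set c := x i / u i with hc
  have hxc : ∀ j, x j ≤ c * u j := fun j => (div_le_iff₀ (hu j)).1 (hi j)
  have hxi : x i = c * u i := by rw [hc, div_mul_cancel₀ _ (hu i).ne']
  have hc0 : 0 < c := by
    have h1 : 0 < x k := lt_of_le_of_ne (hx k) (Ne.symm hk)
    exact (div_pos h1 (hu k)).trans_le (hi k)
  have h1 : (A *ᵥ x) i ≤ c * (A *ᵥ u) i := by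
    rw [Matrix.mulVec, Matrix.mulVec, dotProduct, dotProduct, Finset.mul_sum]
    refine Finset.sum_le_sum fun j _ => ?_
    calc A i j * x j ≤ A i j * (c * u j) := mul_le_mul_of_nonneg_left (hxc j) (hA i j)
      _ = c * (A i j * u j) := by ring
  have h2 := mul_lt_mul_of_pos_left (hAu i) hc0
  have h3 := h i
  rw [hxi] at h3
  linarith

omit [DecidableEq n] in
/-- The modulus of an eigenvector of a nonnegative matrix is subinvariant. -/
lemma norm_mul_le_mulVec_norm {A : Matrix n n ℝ} (hA : ∀ i j, 0 ≤ A i j) {μ : ℂ} {v : n → ℂ}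
    (h : A.map Complex.ofReal *ᵥ v = μ • v) (i : n) :
    ‖μ‖ * ‖v i‖ ≤ (A *ᵥ fun j => ‖v j‖) i := by
  have h1 := congrFun h i
  rw [Pi.smul_apply, smul_eq_mul] at h1
  rw [← norm_mul, ← h1, Matrix.mulVec, Matrix.mulVec, dotProduct, dotProduct]
  refine (norm_sum_le _ _).trans (Finset.sum_le_sum fun j _ => ?_)
  simp [abs_of_nonneg (hA i j)]

/-- The largest real eigenvalue dominates every `‖μ‖`, since the modulus of a `μ`-eigenvector is
subinvariant for `‖μ‖` and so produces a real eigenvalue at least `‖μ‖`. -/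
theorem exists_isPerronEigenvalue_ge {A : Matrix n n ℝ} (hA : ∀ i j, 0 ≤ A i j)
    {τ : ℝ} (hτ : 0 < τ) {x : n → ℝ} (hx : ∀ i, 0 ≤ x i) (hx0 : x ≠ 0)
    (h : ∀ i, τ * x i ≤ (A *ᵥ x) i) :
    ∃ r, τ ≤ r ∧ IsPerronEigenvalue (A.map Complex.ofReal) r := by
  set E : Set ℝ := {t | (t • (1 : Matrix n n ℝ) - A).det = 0} with hE
  have hfin : E.Finite := by
    refine (A.charpoly.roots.toFinset.finite_toSet).subset fun t ht => ?_
    have h1 : A.charpoly.eval t = 0 := by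
      rw [Matrix.eval_charpoly, Matrix.scalar_apply, ← Matrix.smul_one_eq_diagonal]
      exact ht
    simpa [A.charpoly_monic.ne_zero] using h1
  obtain ⟨t₀, ht₀, hdet₀⟩ := exists_det_eq_zero_of_le_mulVec hA hτ hx hx0 h
  obtain ⟨r, hr, hmax⟩ := hfin.exists_maximalFor id E ⟨t₀, hdet₀⟩
  have hle : ∀ t ∈ E, t ≤ r := fun t ht => (le_total t r).elim id fun h' => hmax ht h'
  have hτr : τ ≤ r := ht₀.trans (hle _ hdet₀)
  refine ⟨r, hτr, hτ.trans_le hτr, isMatrixEigenvalue_of_det_eq_zero hr, fun μ hμ => ?_⟩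
  obtain ⟨v, hv, hvμ⟩ := (isMatrixEigenvalue_iff _ _).1 hμ
  rcases (norm_nonneg μ).eq_or_lt with h0 | h0
  · rw [← h0]
    exact (hτ.trans_le hτr).le
  · obtain ⟨t, ht, hdet⟩ := exists_det_eq_zero_of_le_mulVec hA h0 (x := fun j => ‖v j‖)
      (fun _ => norm_nonneg _) (fun h' => hv (funext fun j => by simpa using congrFun h' j))
      (norm_mul_le_mulVec_norm hA hvμ)
    exact ht.trans (hle _ hdet)

/-- A strictly subinvariant vector of an irreducible matrix can be improved. -/
lemma exists_gt_le_mulVec {A : Matrix n n ℝ} (hA : ∀ i j, 0 ≤ A i j)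
    (hirr : ∀ i j, ∃ k : ℕ, 0 < (A ^ k) i j) {r : ℝ} {x : n → ℝ} (hx : ∀ i, 0 ≤ x i) (hx0 : x ≠ 0)
    (h : ∀ i, r * x i ≤ (A *ᵥ x) i) (hne : A *ᵥ x ≠ r • x) :
    ∃ τ, r < τ ∧ ∃ w : n → ℝ, (∀ i, 0 ≤ w i) ∧ w ≠ 0 ∧ ∀ i, τ * w i ≤ (A *ᵥ w) i := by
  have hpow := Matrix.pow_apply_nonneg hA
  choose k hk using hirr
  -- One positive power per pair of indices: `Q` is entrywise positive and commutes with `A`, so it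
  -- turns the nonzero defect `A x - r x ≥ 0` into a strictly positive one.
  set Q : Matrix n n ℝ := ∑ p : n × n, A ^ k p.1 p.2 with hQ
  have hQpos : ∀ i j, 0 < Q i j := by
    intro i j
    rw [hQ, Matrix.sum_apply]
    exact Finset.sum_pos' (fun p _ => hpow _ i j) ⟨(i, j), Finset.mem_univ _, hk i j⟩
  have hcomm : A * Q = Q * A := by
    rw [hQ, Finset.mul_sum, Finset.sum_mul]
    exact Finset.sum_congr rfl fun p _ => (pow_mul_comm' A _).symm
  have hQv : ∀ y : n → ℝ, (∀ i, 0 ≤ y i) → y ≠ 0 → ∀ i, 0 < (Q *ᵥ y) i := by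
    intro y hy hy0 i
    obtain ⟨j, hj⟩ := Function.ne_iff.1 hy0
    exact Finset.sum_pos' (fun l _ => mul_nonneg (hQpos i l).le (hy l))
      ⟨j, Finset.mem_univ _, mul_pos (hQpos i j) (lt_of_le_of_ne (hy j) (Ne.symm hj))⟩
  set w := Q *ᵥ x with hw
  have hwpos := hQv x hx hx0
  have hz := hQv (A *ᵥ x - r • x) (fun i => by simpa using h i) (sub_ne_zero.2 hne)
  have hAw : A *ᵥ w - r • w = Q *ᵥ (A *ᵥ x - r • x) := by
    rw [hw, Matrix.mulVec_sub, Matrix.mulVec_smul, Matrix.mulVec_mulVec, Matrix.mulVec_mulVec,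
      hcomm]
  have : Nonempty n := ⟨(Function.ne_iff.1 hx0).choose⟩
  obtain ⟨i₀, hi₀⟩ := Finite.exists_min fun i => (A *ᵥ w - r • w) i / w i
  refine ⟨r + (A *ᵥ w - r • w) i₀ / w i₀, ?_, w, fun i => (hwpos i).le, ?_, fun i => ?_⟩
  · have : 0 < (A *ᵥ w - r • w) i₀ / w i₀ := by
      rw [hAw]
      exact div_pos (hz i₀) (hwpos i₀)
    linarith
  · intro h0
    have := hwpos i₀
    rw [← hw, h0] at this
    exact lt_irrefl _ this
  · have h1 := (le_div_iff₀ (hwpos i)).1 (hi₀ i)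
    have h2 : (A *ᵥ w - r • w) i = (A *ᵥ w) i - r * w i := by simp
    rw [add_mul]
    linarith

lemma pow_mulVec_of_mulVec_eq {A : Matrix n n ℝ} {r : ℝ} {x : n → ℝ} (h : A *ᵥ x = r • x) (k : ℕ) :
    A ^ k *ᵥ x = r ^ k • x := by
  induction k with
  | zero => simp
  | succ k ih =>
    rw [pow_succ, ← Matrix.mulVec_mulVec, h, Matrix.mulVec_smul, ih, smul_smul, pow_succ, mul_comm]

/-- An irreducible matrix has no eigenvector that is nonnegative, not zero, and vanishes
somewhere. -/
lemma mulVec_ne_smul_of_apply_eq_zero {A : Matrix n n ℝ} (hA : ∀ i j, 0 ≤ A i j)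
    (hirr : ∀ i j, ∃ k : ℕ, 0 < (A ^ k) i j) {r : ℝ} {x : n → ℝ} (hx : ∀ i, 0 ≤ x i) (hx0 : x ≠ 0)
    {i : n} (hi : x i = 0) : A *ᵥ x ≠ r • x := by
  intro h
  have hpow := Matrix.pow_apply_nonneg hA
  obtain ⟨j, hj⟩ := Function.ne_iff.1 hx0
  obtain ⟨k, hk⟩ := hirr i j
  have h1 : 0 < (A ^ k *ᵥ x) i :=
    Finset.sum_pos' (fun l _ => mul_nonneg (hpow k i l) (hx l))
      ⟨j, Finset.mem_univ _, mul_pos hk (lt_of_le_of_ne (hx j) (Ne.symm hj))⟩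
  rw [pow_mulVec_of_mulVec_eq h, Pi.smul_apply, hi, smul_zero] at h1
  exact lt_irrefl _ h1

end Perron

/-! ### Non-backtracking walks and irreducibility. -/

section NonBacktracking

open Relation

variable {V : Type*}

/-- The dart `f` can follow the dart `e` in a non-backtracking walk. -/
def NBStep {G : SimpleGraph V} (e f : G.Dart) : Prop :=
  e.snd = f.fst ∧ e.fst ≠ f.snd

lemma NBStep.symm {G : SimpleGraph V} {e f : G.Dart} (h : NBStep e f) : NBStep f.symm e.symm :=
  ⟨h.1.symm, h.2.symm⟩

lemma reflTransGen_nbStep_symm {G : SimpleGraph V} {e f : G.Dart} (h : ReflTransGen NBStep e f) :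
    ReflTransGen NBStep f.symm e.symm := by
  induction h with
  | refl => exact .refl
  | tail _ h ih => exact .head h.symm ih

lemma exists_adj_ne [Fintype V] {G : SimpleGraph V} [DecidableRel G.Adj]
    (hdeg : ∀ v, 2 ≤ G.degree v) (v a : V) : ∃ w, G.Adj v w ∧ w ≠ a := by
  obtain ⟨w, hw, hwa⟩ := Finset.exists_mem_ne (s := G.neighborFinset v) (hdeg v) a
  exact ⟨w, by simpa using hw, hwa⟩

/-- In a set of darts that is closed under non-backtracking steps, at most as many darts enter a
node as leave it. -/
lemma card_filter_snd_le_card_filter_fst [Fintype V] [DecidableEq V] {G : SimpleGraph V}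
    [DecidableRel G.Adj] (hdeg : ∀ v, 2 ≤ G.degree v) {U : Finset G.Dart}
    (hU : ∀ e ∈ U, ∀ f, NBStep e f → f ∈ U) (v : V) :
    (U.filter fun e => e.snd = v).card ≤ (U.filter fun e => e.fst = v).card := by
  rcases (U.filter fun e => e.snd = v).eq_empty_or_nonempty with h0 | ⟨e, he⟩
  · simp [h0]
  obtain ⟨heU, hev⟩ := Finset.mem_filter.1 he
  by_cases h1 : ∃ e' ∈ U.filter (fun e => e.snd = v), e' ≠ e
  -- With two darts entering `v`, reversal injects entering darts into leaving ones: the reverse of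
  -- `f` follows whichever of `e`, `e'` has a tail other than that of `f`.
  · obtain ⟨e', he', hne⟩ := h1
    obtain ⟨heU', hev'⟩ := Finset.mem_filter.1 he'
    refine Finset.card_le_card_of_injOn SimpleGraph.Dart.symm (fun f hf => ?_)
      SimpleGraph.Dart.symm_involutive.injective.injOn
    have hfv : f.snd = v := (Finset.mem_filter.1 (Finset.mem_coe.1 hf)).2
    refine Finset.mem_coe.2 (Finset.mem_filter.2 ⟨?_, hfv⟩)
    by_cases h2 : e.fst = f.fst
    · refine hU e' heU' _ ⟨hev'.trans hfv.symm, fun h3 => hne ?_⟩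
      exact SimpleGraph.Dart.ext _ _ (Prod.ext (h3.trans h2.symm) (hev'.trans hev.symm))
    · exact hU e heU _ ⟨hev.trans hfv.symm, h2⟩
  · push Not at h1
    obtain ⟨w, hw, hwe⟩ := exists_adj_ne hdeg v e.fst
    calc _ ≤ 1 := Finset.card_le_one.2 fun a ha b hb => (h1 a ha).trans (h1 b hb).symm
      _ ≤ (U.filter fun e => e.fst = v).card := Finset.card_pos.2 ⟨⟨(v, w), hw⟩,
        Finset.mem_filter.2 ⟨hU e heU _ ⟨hev, hwe.symm⟩, rfl⟩⟩

/-- A nonempty set of darts of a connected graph of minimal degree at least `2` that is closed under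
non-backtracking steps enters every node. -/
lemma exists_mem_snd_eq [Fintype V] [DecidableEq V] {G : SimpleGraph V} [DecidableRel G.Adj]
    (hconn : G.Connected) (hdeg : ∀ v, 2 ≤ G.degree v) {U : Finset G.Dart}
    (hU : ∀ e ∈ U, ∀ f, NBStep e f → f ∈ U) (hne : U.Nonempty) (v : V) :
    ∃ e ∈ U, e.snd = v := by
  have hle := card_filter_snd_le_card_filter_fst hdeg hU
  have hsum : ∑ v, (U.filter fun e => e.snd = v).card = ∑ v, (U.filter fun e => e.fst = v).card := by
    rw [← Finset.card_eq_sum_card_fiberwise (fun _ _ => Finset.mem_coe.2 (Finset.mem_univ _)),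
      ← Finset.card_eq_sum_card_fiberwise (fun _ _ => Finset.mem_coe.2 (Finset.mem_univ _))]
  -- Both counts total `U.card`, so the inequality is an equality at every node; a node that `U`
  -- leaves is thus also entered.
  have heq := (Finset.sum_eq_sum_iff_of_le fun v _ => hle v).1 hsum
  obtain ⟨e₀, he₀⟩ := hne
  have hreach := (SimpleGraph.reachable_iff_reflTransGen _ _).1 (hconn.preconnected e₀.snd v)
  induction hreach with
  | refl => exact ⟨e₀, he₀, rfl⟩
  | @tail k l _ hkl ih =>
    obtain ⟨e, he, hek⟩ := ih
    by_cases h : e.fst = l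
    · have h1 : 0 < (U.filter fun e => e.fst = l).card :=
        Finset.card_pos.2 ⟨e, Finset.mem_filter.2 ⟨he, h⟩⟩
      rw [← heq l (Finset.mem_univ _)] at h1
      obtain ⟨f, hf⟩ := Finset.card_pos.1 h1
      exact ⟨f, (Finset.mem_filter.1 hf).1, (Finset.mem_filter.1 hf).2⟩
    · exact ⟨⟨(k, l), hkl⟩, hU e he _ ⟨hek, h⟩, rfl⟩

lemma exists_reflTransGen_nbStep_snd_eq [Fintype V] {G : SimpleGraph V}
    [DecidableRel G.Adj] (hconn : G.Connected) (hdeg : ∀ v, 2 ≤ G.degree v) (e : G.Dart) (v : V) :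
    ∃ f, ReflTransGen NBStep e f ∧ f.snd = v := by
  classical
  obtain ⟨f, hf, hfv⟩ := exists_mem_snd_eq hconn hdeg
    (U := Finset.univ.filter fun f => ReflTransGen NBStep e f)
    (fun f hf g hfg => by
      simp only [Finset.mem_filter, Finset.mem_univ, true_and] at hf ⊢
      exact hf.tail hfg)
    ⟨e, by simpa using ReflTransGen.refl⟩ v
  exact ⟨f, by simpa using hf, hfv⟩

/-- The dart from `s` to the new node. -/
def inDart (G : SimpleGraph V) {S : Finset V} {s : V} (hs : s ∈ S) : (addNode G S).Dart :=
  ⟨(some s, none), hs⟩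

/-- The dart from the new node to `s`. -/
def outDart (G : SimpleGraph V) {S : Finset V} {s : V} (hs : s ∈ S) : (addNode G S).Dart :=
  ⟨(none, some s), hs⟩

lemma dart_addNode_cases {G : SimpleGraph V} {S : Finset V} {p : (addNode G S).Dart → Prop}
    (hold : ∀ e, p (oldDart G S e)) (hin : ∀ s (hs : s ∈ S), p (inDart G hs))
    (hout : ∀ s (hs : s ∈ S), p (outDart G hs)) (e : (addNode G S).Dart) : p e := by
  rcases e with ⟨⟨_ | u, _ | v⟩, h⟩
  · exact h.elim
  · exact hout v h
  · exact hin u h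
  · exact hold ⟨(u, v), h⟩

variable [Fintype V] {G : SimpleGraph V} [DecidableRel G.Adj] {S : Finset V}

lemma reflTransGen_oldDart_inDart (hconn : G.Connected) (hdeg : ∀ v, 2 ≤ G.degree v) (e : G.Dart)
    {s : V} (hs : s ∈ S) : ReflTransGen NBStep (oldDart G S e) (inDart G hs) := by
  obtain ⟨f, hf, hfs⟩ := exists_reflTransGen_nbStep_snd_eq hconn hdeg e s
  have hlift : ReflTransGen NBStep (oldDart G S e) (oldDart G S f) :=
    ReflTransGen.lift (r := NBStep) (p := NBStep) (oldDart G S) (fun _ _ h =>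
      ⟨congrArg some h.1, fun h' => h.2 (Option.some_injective _ h')⟩) _ _ hf
  exact hlift.tail ⟨congrArg some hfs, Option.some_ne_none _⟩

lemma reflTransGen_outDart_inDart (hconn : G.Connected) (hdeg : ∀ v, 2 ≤ G.degree v)
    {s t : V} (hs : s ∈ S) (ht : t ∈ S) :
    ReflTransGen NBStep (outDart G hs) (inDart G ht) := by
  obtain ⟨l, hl, -⟩ := exists_adj_ne hdeg s s
  have hstep : NBStep (outDart G hs) (oldDart G S ⟨(s, l), hl⟩) :=
    ⟨rfl, (Option.some_ne_none l).symm⟩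
  exact .head hstep (reflTransGen_oldDart_inDart hconn hdeg ⟨(s, l), hl⟩ ht)

omit [Fintype V] [DecidableRel G.Adj] in
lemma nbStep_inDart_outDart {s t : V} (hs : s ∈ S) (ht : t ∈ S) (h : s ≠ t) :
    NBStep (inDart G hs) (outDart G ht) :=
  ⟨rfl, fun h' => h (Option.some_injective _ h')⟩

lemma reflTransGen_outDart (hconn : G.Connected) (hdeg : ∀ v, 2 ≤ G.degree v) (hS : 2 ≤ S.card)
    (e : (addNode G S).Dart) {s : V} (hs : s ∈ S) :
    ReflTransGen NBStep e (outDart G hs) := by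
  obtain ⟨t, ht, hts⟩ := Finset.exists_mem_ne hS s
  refine dart_addNode_cases (p := fun e => ReflTransGen NBStep e (outDart G hs)) (fun e => ?_)
    (fun a ha => ?_) (fun a ha => ?_) e
  · exact (reflTransGen_oldDart_inDart hconn hdeg e ht).tail (nbStep_inDart_outDart ht hs hts)
  · by_cases h : a = s
    -- Going straight back to `s` would backtrack, so the walk leaves `c` towards `t`, returns from
    -- `t` to `c`, and then goes to `s`.
    · exact .head (nbStep_inDart_outDart ha ht (h.trans_ne hts.symm))
        ((reflTransGen_outDart_inDart hconn hdeg ht ht).tail (nbStep_inDart_outDart ht hs hts))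
    · exact .single (nbStep_inDart_outDart ha hs h)
  · exact (reflTransGen_outDart_inDart hconn hdeg ha ht).tail (nbStep_inDart_outDart ht hs hts)

/-- Any two darts of `addNode G S` are joined by a non-backtracking walk. -/
theorem reflTransGen_nbStep_addNode (hconn : G.Connected) (hdeg : ∀ v, 2 ≤ G.degree v)
    (hS : 2 ≤ S.card) (e f : (addNode G S).Dart) : ReflTransGen NBStep e f := by
  obtain ⟨s, hs⟩ := Finset.card_pos.1 (two_pos.trans_le hS)
  -- The dart into `c` from `s` is the reverse of the one out to `s`, so reversing a walk from
  -- `f.symm` to the latter leads from the former to `f`.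
  exact ((reflTransGen_outDart hconn hdeg hS e hs).trans
    (reflTransGen_outDart_inDart hconn hdeg hs hs)).trans
    (reflTransGen_nbStep_symm (reflTransGen_outDart hconn hdeg hS f.symm hs))

end NonBacktracking

/-! ### Non-backtracking matrices and their blocks. -/

section NBMatrix

variable {V : Type*} [DecidableEq V]

/-- The non-backtracking matrix with real entries. -/
def nbMatrixReal (G : SimpleGraph V) : Matrix G.Dart G.Dart ℝ :=
  Matrix.of fun e f => if f.snd = e.fst ∧ f.fst ≠ e.snd then 1 else 0

lemma map_nbMatrixReal (G : SimpleGraph V) : (nbMatrixReal G).map Complex.ofReal = nbMatrix G := by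
  ext e f
  simp only [nbMatrixReal, nbMatrix, Matrix.map_apply, Matrix.of_apply]
  split <;> simp

lemma nbMatrixReal_nonneg (G : SimpleGraph V) (e f : G.Dart) : 0 ≤ nbMatrixReal G e f := by
  simp only [nbMatrixReal, Matrix.of_apply]
  split <;> norm_num

lemma nbMatrixReal_eq_one {G : SimpleGraph V} {e f : G.Dart} (h : NBStep f e) :
    nbMatrixReal G e f = 1 := by
  simp only [nbMatrixReal, Matrix.of_apply]
  exact if_pos h

lemma nbMatrixReal_oldDart (G : SimpleGraph V) (S : Finset V) (e f : G.Dart) :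
    nbMatrixReal (addNode G S) (oldDart G S e) (oldDart G S f) = nbMatrixReal G e f := by
  simp [nbMatrixReal, oldDart]

lemma nbMatrix_oldDart (G : SimpleGraph V) (S : Finset V) (e f : G.Dart) :
    nbMatrix (addNode G S) (oldDart G S e) (oldDart G S f) = nbMatrix G e f := by
  simp [nbMatrix, oldDart]

/-- Matrix rows index the later dart of a step, hence the swapped indices. -/
lemma exists_pow_nbMatrixReal_pos [Fintype V] {G : SimpleGraph V} [DecidableRel G.Adj]
    {e f : G.Dart} (h : Relation.ReflTransGen NBStep e f) :
    ∃ k : ℕ, 0 < (nbMatrixReal G ^ k) f e := by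
  induction h with
  | refl => exact ⟨0, by simp⟩
  | @tail f g _ hfg ih =>
    obtain ⟨k, hk⟩ := ih
    refine ⟨k + 1, ?_⟩
    rw [pow_succ', Matrix.mul_apply]
    exact Finset.sum_pos' (fun l _ => mul_nonneg (nbMatrixReal_nonneg G _ _) (pow_apply_nonneg
      (nbMatrixReal_nonneg G) k _ _))
      ⟨f, Finset.mem_univ _, by rw [nbMatrixReal_eq_one hfg, one_mul]; exact hk⟩

lemma one_le_nbMatrixReal_mulVec_one [Fintype V] {G : SimpleGraph V} [DecidableRel G.Adj]
    (hdeg : ∀ v, 2 ≤ G.degree v) (e : G.Dart) : 1 ≤ (nbMatrixReal G *ᵥ 1) e := by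
  obtain ⟨w, hw, hwe⟩ := exists_adj_ne hdeg e.fst e.snd
  have h1 : NBStep (⟨(w, e.fst), hw.symm⟩ : G.Dart) e := ⟨rfl, hwe⟩
  simp only [Matrix.mulVec, dotProduct, Pi.one_apply, mul_one]
  rw [← nbMatrixReal_eq_one h1]
  exact Finset.single_le_sum (f := fun f => nbMatrixReal G e f) (fun f _ => nbMatrixReal_nonneg G e f) (Finset.mem_univ _)

omit [DecidableEq V] in
lemma oldDart_injective (G : SimpleGraph V) (S : Finset V) : Function.Injective (oldDart G S) := by
  intro e f h
  have h1 := congrArg (fun d => d.fst) h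
  have h2 := congrArg (fun d => d.snd) h
  exact SimpleGraph.Dart.ext _ _
    (Prod.ext (Option.some_injective _ h1) (Option.some_injective _ h2))

/-- The darts of `addNode G S` are the old and the new ones. -/
noncomputable def dartAddNodeEquiv (G : SimpleGraph V) (S : Finset V) :
    G.Dart ⊕ NewDart G S ≃ (addNode G S).Dart :=
  Equiv.ofBijective (Sum.elim (oldDart G S) Subtype.val) <| by
    refine ⟨(oldDart_injective G S).sumElim Subtype.val_injective ?_, ?_⟩
    · rintro e ⟨f, hf⟩ rfl
      rcases hf with h | h <;> exact Option.some_ne_none _ h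
    · exact dart_addNode_cases (fun e => ⟨.inl e, rfl⟩) (fun s hs => ⟨.inr ⟨_, .inr rfl⟩, rfl⟩)
        (fun s hs => ⟨.inr ⟨_, .inl rfl⟩, rfl⟩)

variable [Fintype V] (G : SimpleGraph V) [DecidableRel G.Adj] (S : Finset V)

lemma sum_dart_addNode {M : Type*} [AddCommMonoid M] (f : (addNode G S).Dart → M) :
    ∑ e, f e = ∑ e, f (oldDart G S e) + ∑ e : NewDart G S, f e := by
  rw [← (dartAddNodeEquiv G S).sum_comp, Fintype.sum_sum_type]
  rfl

lemma nbMatrix_addNode_mulVec_oldDart (v : (addNode G S).Dart → ℂ) :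
    (nbMatrix (addNode G S) *ᵥ v) ∘ oldDart G S =
      nbMatrix G *ᵥ (v ∘ oldDart G S) + blockD G S *ᵥ (v ∘ Subtype.val) := by
  funext e
  simp only [Function.comp_apply, Matrix.mulVec, dotProduct, Pi.add_apply]
  rw [sum_dart_addNode]
  simp only [nbMatrix_oldDart]
  rfl

lemma nbMatrix_addNode_mulVec_newDart (v : (addNode G S).Dart → ℂ) :
    (nbMatrix (addNode G S) *ᵥ v) ∘ (Subtype.val : NewDart G S → _) =
      blockE G S *ᵥ (v ∘ oldDart G S) + blockF G S *ᵥ (v ∘ Subtype.val) := by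
  funext e
  simp only [Function.comp_apply, Matrix.mulVec, dotProduct, Pi.add_apply]
  rw [sum_dart_addNode]
  rfl

/-- A nonzero entry of `D` needs a new dart leaving `c`, one of `E` a new dart entering `c`. -/
lemma blockD_mul_blockE : blockD G S * blockE G S = 0 := by
  ext e f
  rw [Matrix.mul_apply]
  refine Finset.sum_eq_zero fun g _ => ?_
  simp only [blockD, blockE, nbMatrix, Matrix.submatrix_apply, Matrix.of_apply]
  split_ifs with h1 h2 <;> simp
  rcases g.2 with h | h
  · exact Option.some_ne_none _ (h2.1.trans h)
  · exact Option.some_ne_none _ (h1.1.symm.trans h)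

/-- `F` only leads from darts entering `c` to darts leaving it; a new dart following a dart out of
`c` would backtrack. -/
lemma blockF_mul_blockF : blockF G S * blockF G S = 0 := by
  ext e f
  rw [Matrix.mul_apply]
  refine Finset.sum_eq_zero fun g _ => ?_
  simp only [blockF, nbMatrix, Matrix.submatrix_apply, Matrix.of_apply]
  split_ifs with h1 h2 <;> simp
  have hg := g.1.fst_ne_snd
  rcases g.2 with h | h
  · rcases e.2 with h' | h'
    · exact hg (h.trans (h1.1.trans h').symm)
    · exact h1.2 (h.trans h'.symm)
  · rcases f.2 with h' | h'
    · exact h2.2 (h'.trans h.symm)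
    · exact hg ((h2.1.symm.trans h').trans h.symm)

variable {G S}

/-- An eigenvalue `t` of the non-backtracking matrix of `addNode G S` that is neither zero nor an
eigenvalue of that of `G` makes `-t²` an eigenvalue of `Y(t) X`. -/
theorem isMatrixEigenvalue_resolventY_mul_nodeX {t : ℂ} (ht : t ≠ 0)
    (hunit : IsUnit (nbMatrix G - t • (1 : Matrix G.Dart G.Dart ℂ)))
    (h : IsMatrixEigenvalue (nbMatrix (addNode G S)) t) :
    IsMatrixEigenvalue (resolventY G t * nodeX G S) (-t ^ 2) := by
  obtain ⟨v, hv, hvt⟩ := (isMatrixEigenvalue_iff _ _).1 h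
  set x : G.Dart → ℂ := v ∘ oldDart G S with hx
  set y : NewDart G S → ℂ := v ∘ Subtype.val with hy
  have h1 : nbMatrix G *ᵥ x + blockD G S *ᵥ y = t • x := by
    rw [hx, hy, ← nbMatrix_addNode_mulVec_oldDart, hvt]
    rfl
  have h2 : blockE G S *ᵥ x + blockF G S *ᵥ y = t • y := by
    rw [hx, hy, ← nbMatrix_addNode_mulVec_newDart, hvt]
    rfl
  have h3 : blockF G S *ᵥ (blockE G S *ᵥ x) = t • blockF G S *ᵥ y := by
    have := congrArg (fun z => blockF G S *ᵥ z) h2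
    simpa only [Matrix.mulVec_add, Matrix.mulVec_mulVec, blockF_mul_blockF, Matrix.zero_mulVec,
      add_zero, Matrix.mulVec_smul] using this
  have h4 : t ^ 2 • blockD G S *ᵥ y = nodeX G S *ᵥ x := by
    have h5 : blockD G S *ᵥ (blockF G S *ᵥ y) = t • blockD G S *ᵥ y := by
      rw [← Matrix.mulVec_smul, ← h2, Matrix.mulVec_add, Matrix.mulVec_mulVec _ _ (blockE G S),
        blockD_mul_blockE, Matrix.zero_mulVec, zero_add]
    rw [nodeX, ← Matrix.mulVec_mulVec, ← Matrix.mulVec_mulVec, h3, Matrix.mulVec_smul, h5,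
      smul_smul, sq]
  -- If `x = 0`, then `F y = t y`, which the nilpotency of `F` and `t ≠ 0` forbid unless `y = 0`.
  have hx0 : x ≠ 0 := by
    intro h0
    rw [h0, Matrix.mulVec_zero] at h3
    rw [h0, Matrix.mulVec_zero, zero_add] at h2
    have h5 : blockF G S *ᵥ y = 0 := by
      rw [Matrix.mulVec_zero] at h3
      exact (smul_eq_zero.1 h3.symm).resolve_left ht
    have hy0 : y = 0 := (smul_eq_zero.1 (h2.symm.trans h5)).resolve_left ht
    refine hv (funext fun e => ?_)
    obtain ⟨e | e, rfl⟩ := (dartAddNodeEquiv G S).surjective e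
    · exact congrFun h0 e
    · exact congrFun hy0 e
  refine (isMatrixEigenvalue_iff _ _).2 ⟨x, hx0, ?_⟩
  have h6 : (nbMatrix G - t • (1 : Matrix G.Dart G.Dart ℂ)) *ᵥ (-t ^ 2 • x) = nodeX G S *ᵥ x := by
    rw [Matrix.mulVec_smul, Matrix.sub_mulVec, Matrix.smul_mulVec, Matrix.one_mulVec, ← h1, ← h4,
      sub_add_cancel_left, smul_neg, neg_smul, neg_neg]
  rw [← Matrix.mulVec_mulVec, ← h6, resolventY, Matrix.mulVec_mulVec,
    Matrix.nonsing_inv_mul _ ((Matrix.isUnit_iff_isUnit_det _).1 hunit), Matrix.one_mulVec]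

end NBMatrix

/-! ### Strict increase of the Perron eigenvalue. -/

theorem mainTheorem9 {V : Type*} [Fintype V] [DecidableEq V]
    (G : SimpleGraph V) [DecidableRel G.Adj]
    (hconn : G.Connected) (hdeg : ∀ v, 2 ≤ G.degree v)
    (hdiag : IsDiagonalizableMatrix (nbMatrix G))
    (S : Finset V) (hS : 2 ≤ S.card) :
    ∃ lam lamc : ℝ,
      IsPerronEigenvalue (nbMatrix G) lam ∧
      lam < lamc ∧
      IsUnit (nbMatrix G - (lamc : ℂ) • (1 : Matrix G.Dart G.Dart ℂ)) ∧
      IsMatrixEigenvalue (resolventY G (lamc : ℂ) * nodeX G S) (-(lamc : ℂ) ^ 2) ∧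
      IsPerronEigenvalue (nbMatrix (addNode G S)) lamc := by
  obtain ⟨u⟩ := hconn.nonempty
  obtain ⟨w, hw, -⟩ := exists_adj_ne hdeg u u
  obtain ⟨lam, -, hlam⟩ := exists_isPerronEigenvalue_ge (nbMatrixReal_nonneg G) one_pos (x := 1)
    (fun _ => zero_le_one) (fun h => one_ne_zero (congrFun h (⟨(u, w), hw⟩ : G.Dart)))
    (fun e => by simpa using one_le_nbMatrixReal_mulVec_one hdeg e)
  rw [map_nbMatrixReal] at hlam
  obtain ⟨v, hv, hvlam⟩ := (isMatrixEigenvalue_iff _ _).1 hlam.2.1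
  have hsub := norm_mul_le_mulVec_norm (nbMatrixReal_nonneg G) (by rwa [map_nbMatrixReal])
    (v := v) (μ := (lam : ℂ))
  rw [Complex.norm_real, Real.norm_of_nonneg hlam.1.le] at hsub
  set x : (addNode G S).Dart → ℝ :=
    fun e => Sum.elim (fun e => ‖v e‖) 0 ((dartAddNodeEquiv G S).symm e) with hx
  have hxold : ∀ e, x (oldDart G S e) = ‖v e‖ := fun e => by
    have : (dartAddNodeEquiv G S).symm (oldDart G S e) = .inl e :=
      (Equiv.symm_apply_eq _).2 rfl
    simp [hx, this]
  have hxnew : ∀ e : NewDart G S, x e = 0 := fun e => by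
    have : (dartAddNodeEquiv G S).symm e = .inr e := (Equiv.symm_apply_eq _).2 rfl
    simp [hx, this]
  have hxnn : ∀ e, 0 ≤ x e := fun e => by
    obtain ⟨e | e, rfl⟩ := (dartAddNodeEquiv G S).surjective e
    · exact (norm_nonneg _).trans_eq (hxold e).symm
    · exact (hxnew e).ge
  have hx0 : x ≠ 0 := fun h => hv (funext fun e => by
    have := hxold e
    rw [h] at this
    exact norm_eq_zero.1 this.symm)
  -- Old rows reduce to the inequality for `B`; in new rows the left side is zero.
  have hxsub : ∀ e, lam * x e ≤ (nbMatrixReal (addNode G S) *ᵥ x) e := fun e => by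
    obtain ⟨e | e, rfl⟩ := (dartAddNodeEquiv G S).surjective e
    · change lam * x (oldDart G S e) ≤ (nbMatrixReal (addNode G S) *ᵥ x) (oldDart G S e)
      rw [hxold, Matrix.mulVec, dotProduct, sum_dart_addNode]
      simp only [nbMatrixReal_oldDart, hxold, hxnew, mul_zero, Finset.sum_const_zero, add_zero]
      exact hsub e
    · change lam * x e ≤ _
      rw [hxnew, mul_zero]
      exact Finset.sum_nonneg fun f _ => mul_nonneg (nbMatrixReal_nonneg _ _ _) (hxnn f)
  have hirr : ∀ e f, ∃ k : ℕ, 0 < (nbMatrixReal (addNode G S) ^ k) e f := fun e f =>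
    exists_pow_nbMatrixReal_pos (reflTransGen_nbStep_addNode hconn hdeg hS f e)
  obtain ⟨s, hs⟩ := Finset.card_pos.1 (two_pos.trans_le hS)
  have hne := mulVec_ne_smul_of_apply_eq_zero (nbMatrixReal_nonneg _) hirr hxnn hx0 (r := lam)
    (hxnew ⟨inDart G hs, .inr rfl⟩)
  obtain ⟨τ, hτ, z, hz, hz0, hzτ⟩ :=
    exists_gt_le_mulVec (nbMatrixReal_nonneg _) hirr hxnn hx0 hxsub hne
  obtain ⟨lamc, hτc, hlamc⟩ := exists_isPerronEigenvalue_ge (nbMatrixReal_nonneg _)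
    (hlam.1.trans hτ) hz hz0 hzτ
  rw [map_nbMatrixReal] at hlamc
  have hlt : lam < lamc := hτ.trans_le hτc
  have hunit : IsUnit (nbMatrix G - (lamc : ℂ) • (1 : Matrix G.Dart G.Dart ℂ)) := by
    rw [Matrix.isUnit_iff_isUnit_det, isUnit_iff_ne_zero]
    intro h0
    obtain ⟨y, hy, hy0⟩ := Matrix.exists_mulVec_eq_zero_iff.2 h0
    rw [Matrix.sub_mulVec, Matrix.smul_mulVec, Matrix.one_mulVec, sub_eq_zero] at hy0
    have := hlam.2.2 _ ((isMatrixEigenvalue_iff _ _).2 ⟨y, hy, hy0⟩)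
    rw [Complex.norm_real, Real.norm_of_nonneg hlamc.1.le] at this
    exact hlt.not_ge this
  exact ⟨lam, lamc, hlam, hlt, hunit, isMatrixEigenvalue_resolventY_mul_nodeX
    (Complex.ofReal_ne_zero.2 hlamc.1.ne') hunit hlamc.2.1, hlamc⟩
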